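/- Let $n\ge 2$ and $k\ge 2$. The de Bruijn graph $B(n,k)$ is the directed graph whose nodes are the $k^n$ words of length $n$ over a $k$-letter alphabet $A$ and whose edges are $x_1x_2\cdots x_n\rightarrow x_2\cdots x_nx_{n+1}$ for $x_1,\dots,x_{n+1}\in A$. A Hamiltonian cycle in $B(n,k)$ is a sequence $v_1,\dots,v_t$ of distinct nodes that contains all nodes and such that $v_i\rightarrow v_{i+1}$ is an edge for $1\le i\le t-1$ and $v_t\rightarrow v_1$ is an edge; it goes through these $t$ edges. A node is out-special if it has the form $yx^{n-1}$, and in-special if it has the form $x^{n-1}y$, where $x,y\in A$ and $x\ne y$. Theorem. Let $a\rightarrow b$ be an edge of $B(n,k)$ that is not a loop, that is, $a\ne b$. Then there exists a Hamiltonian cycle in $B(n,k)$ that goes through $a\rightarrow b$, with the only exception of the case when $k=2$, $a$ is out-special and $b$ is in-special; in this exceptional case no Hamiltonian cycle goes through $a\rightarrow b$. -/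

import Mathlib

namespace DeBruijn

/-- The de Bruijn graph `B(n,k)`: its nodes are the words of length `n` over a `k`-letter alphabet,
and its edges are `x₁x₂⋯xₙ → x₂⋯xₙxₙ₊₁`, one for every word `x₁x₂⋯xₙ₊₁`. -/
def graph (n k : ℕ) : Digraph (Fin n → Fin k) where
  Adj a b := ∃ x : Fin (n + 1) → Fin k, (∀ i : Fin n, a i = x i.castSucc) ∧
    (∀ i : Fin n, b i = x i.succ)

/-- The node `w` is out-special: it has the form `y xⁿ⁻¹` with letters `y ≠ x`. -/
def OutSpecial {n k : ℕ} (w : Fin n → Fin k) : Prop :=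
  ∃ x y : Fin k, y ≠ x ∧ ∀ i : Fin n, w i = if (i : ℕ) = 0 then y else x

/-- The node `w` is in-special: it has the form `xⁿ⁻¹ y` with letters `y ≠ x`. -/
def InSpecial {n k : ℕ} (w : Fin n → Fin k) : Prop :=
  ∃ x y : Fin k, y ≠ x ∧ ∀ i : Fin n, w i = if (i : ℕ) + 1 = n then y else x

/-- The list `l` is a directed path of `G`: its nodes are distinct and each one is joined to the
next one by an edge. -/
def IsPath {V : Type*} (G : Digraph V) (l : List V) : Prop :=
  l.Nodup ∧ l.IsChain G.Adj

/-- A Hamiltonian path of `G` is a directed path that contains all nodes of `G`. -/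
def IsHamiltonianPath {V : Type*} (G : Digraph V) (l : List V) : Prop :=
  IsPath G l ∧ ∀ v : V, v ∈ l

/-- A Hamiltonian cycle of `G`, listed from any of its nodes, is a closed Hamiltonian path: there is
an edge from its last node to its first node. -/
def IsHamiltonianCycle {V : Type*} (G : Digraph V) (l : List V) : Prop :=
  IsHamiltonianPath G l ∧ ∃ h : l ≠ [], G.Adj (l.getLast h) (l.head h)

/-- The closed path listed by `l` goes through the edge `a → b`: either `a` and `b` stand next to
each other, in this order, in `l`, or `a → b` is the closing edge from the last node to the first. -/
def GoesThrough {V : Type*} (l : List V) (a b : V) : Prop :=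
  [a, b] <:+: l ∨ ∃ h : l ≠ [], l.getLast h = a ∧ l.head h = b

end DeBruijn

/-! A Hamiltonian cycle is a one-cycle permutation `σ` moving words along edges. Exchanging the
images of two words with a common tail keeps the edges, and merges their cycles if these differ.
Start from a rotation adjusted so that `σ a = b` and merge without touching `a`, until words other
than `a` with a common tail share a cycle (`exists_sameCycle_of_swap_stable`). Read words as edges
from `init` to `tail` between shorter words. A Hamiltonian cycle of shorter words links all edges
that meet a vertex other than `v₀ = tail a` (`IsEdgePerm.sameCycle_of_tail`). Only a loop at `v₀`
can stay apart; a third edge into `v₀` absorbs it, and is missing only in the exceptional case. -/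

namespace DeBruijn

open Equiv Equiv.Perm

/-! ### Merging cycles of a permutation -/

section Merging

variable {V : Type*} [DecidableEq V]

/-- Swapping the images of two elements of different cycles merges these two cycles. -/
theorem sameCycle_mul_swap [Finite V] {σ : Perm V} {w w' : V} (h : ¬ σ.SameCycle w w') :
    (σ * swap w w').SameCycle w w' := by
  have hw : (σ * swap w w') w = σ w' := by simp
  have hw' : (σ * swap w w') w' = σ w := by simp
  -- From `w` the new permutation jumps to `σ w'` and follows the old cycle of `w'`, which never
  -- meets `w`.
  have key : ∀ i : ℕ, (σ * swap w w').SameCycle w ((σ ^ (i + 1)) w') := by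
    intro i
    induction i with
    | zero =>
      rw [zero_add, pow_one, ← hw, sameCycle_apply_right]
    | succ i ih =>
      rw [pow_succ', mul_apply]
      set y := (σ ^ (i + 1)) w' with hy
      have hyw : y ≠ w := by
        intro e
        exact h (SameCycle.symm ⟨((i + 1 : ℕ) : ℤ), by rw [zpow_natCast, ← hy, e]⟩)
      by_cases hyw' : y = w'
      · rw [hyw', ← hw, sameCycle_apply_right]
      · have : (σ * swap w w') y = σ y := by
          rw [mul_apply, swap_apply_of_ne_of_ne hyw hyw']
        rwa [← this, sameCycle_apply_right]
  have := key (orderOf σ - 1)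
  rwa [Nat.sub_add_cancel (orderOf_pos σ), pow_orderOf_eq_one] at this

theorem sameCycle_mul_swap_of_sameCycle [Finite V] {σ : Perm V} {w w' : V} (h : ¬ σ.SameCycle w w')
    {x y : V} (hxy : σ.SameCycle x y) : (σ * swap w w').SameCycle x y := by
  have hww := sameCycle_mul_swap h
  have step : ∀ x, (σ * swap w w').SameCycle x (σ x) := by
    intro x
    by_cases h1 : x = w
    · subst h1
      have : (σ * swap x w') w' = σ x := by simp
      rw [← this, sameCycle_apply_right]
      exact hww
    by_cases h2 : x = w'
    · subst h2
      have : (σ * swap w x) w = σ x := by simp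
      rw [← this, sameCycle_apply_right]
      exact hww.symm
    · have : (σ * swap w w') x = σ x := by rw [mul_apply, swap_apply_of_ne_of_ne h1 h2]
      rw [← this, sameCycle_apply_right]
  obtain ⟨i, rfl⟩ := hxy.exists_nat_pow_eq
  clear hxy
  induction i with
  | zero => exact SameCycle.refl _ _
  | succ i ih =>
    rw [pow_succ', mul_apply]
    exact ih.trans (step _)

/-- A nonempty family of permutations that is stable under swapping the images of `F`-related
elements contains a permutation for which `F`-related elements lie in the same cycle. -/
theorem exists_sameCycle_of_swap_stable [Finite V] (S : Set (Perm V)) (hS : S.Nonempty)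
    (F : V → V → Prop) (hF : ∀ σ ∈ S, ∀ w w', F w w' → σ * swap w w' ∈ S) :
    ∃ σ ∈ S, ∀ w w', F w w' → σ.SameCycle w w' := by
  -- Merging two cycles would increase the number of pairs sharing a cycle.
  obtain ⟨σ, hσ, hmax⟩ := Set.exists_max_image S
    (fun σ => {p : V × V | σ.SameCycle p.1 p.2}.ncard) S.toFinite hS
  refine ⟨σ, hσ, fun w w' hww => ?_⟩
  by_contra h
  refine absurd (hmax _ (hF σ hσ w w' hww)) (not_le.2 (Set.ncard_lt_ncard ?_ (Set.toFinite _)))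
  refine ⟨fun p hp => sameCycle_mul_swap_of_sameCycle h hp, fun hsub => h ?_⟩
  exact hsub (a := (w, w')) (sameCycle_mul_swap h)

end Merging

/-! ### Permutations along de Bruijn edges -/

section Words

variable {m k : ℕ}

theorem graph_adj_iff {a b : Fin (m + 1) → Fin k} :
    (graph (m + 1) k).Adj a b ↔ Fin.tail a = Fin.init b := by
  constructor
  · rintro ⟨x, hx, hy⟩
    funext i
    simp only [Fin.tail, Fin.init, hx, hy, Fin.succ_castSucc]
  · intro h
    refine ⟨Fin.cons (a 0) b, fun i => ?_, fun i => by simp⟩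
    refine Fin.cases (by simp) (fun j => ?_) i
    rw [← Fin.succ_castSucc, Fin.cons_succ]
    exact congrFun h j

/-- Cyclic rotation of words by one letter. -/
def rotation (m k : ℕ) : Perm (Fin (m + 1) → Fin k) where
  toFun w := Fin.snoc (Fin.tail w) (w 0)
  invFun w := Fin.cons (w (Fin.last m)) (Fin.init w)
  left_inv w := by simp
  right_inv w := by simp

theorem tail_eq_init_rotation (w : Fin (m + 1) → Fin k) :
    Fin.tail w = Fin.init (rotation m k w) := by
  simp [rotation]

/-- The permutation moves every word along an edge of the de Bruijn graph. -/
def IsEdgePerm (σ : Perm (Fin (m + 1) → Fin k)) : Prop :=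
  ∀ w, Fin.tail w = Fin.init (σ w)

theorem IsEdgePerm.mul_swap {σ : Perm (Fin (m + 1) → Fin k)} (hσ : IsEdgePerm σ)
    {w w' : Fin (m + 1) → Fin k} (h : Fin.tail w = Fin.tail w') :
    IsEdgePerm (σ * swap w w') := by
  intro x
  rw [mul_apply, ← hσ]
  by_cases h1 : x = w
  · rw [h1, swap_apply_left, h]
  by_cases h2 : x = w'
  · rw [h2, swap_apply_right, h]
  · rw [swap_apply_of_ne_of_ne h1 h2]

theorem exists_isEdgePerm_apply_eq {a b : Fin (m + 1) → Fin k} (hab : Fin.tail a = Fin.init b) :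
    ∃ σ : Perm (Fin (m + 1) → Fin k), IsEdgePerm σ ∧ σ a = b := by
  refine ⟨rotation m k * swap a ((rotation m k).symm b), ?_, by simp⟩
  refine IsEdgePerm.mul_swap tail_eq_init_rotation ?_
  rw [hab, tail_eq_init_rotation, apply_symm_apply]

theorem exists_hamiltonian_perm (m k : ℕ) :
    ∃ σ : Perm (Fin (m + 1) → Fin k), IsEdgePerm σ ∧ ∀ x y, σ.SameCycle x y := by
  obtain ⟨σ, hσ, hsame⟩ := exists_sameCycle_of_swap_stable {σ | IsEdgePerm σ}
    ⟨rotation m k, tail_eq_init_rotation⟩ (fun w w' => Fin.tail w = Fin.tail w')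
    (fun σ hσ w w' h => IsEdgePerm.mul_swap hσ h)
  refine ⟨σ, hσ, fun x y => ?_⟩
  have step : ∀ w u, Fin.tail w = Fin.init u → σ.SameCycle w u := by
    intro w u h
    rw [← σ.apply_symm_apply u, sameCycle_apply_right]
    exact hsame _ _ (by rw [h, hσ, apply_symm_apply])
  -- The windows of the concatenation `xy` form a walk from `x` to `y`.
  let s : ℕ → Fin k := fun j => if j < m + 1 then x (Fin.ofNat (m + 1) j)
    else y (Fin.ofNat (m + 1) j)
  have key : ∀ j : ℕ, σ.SameCycle x (fun i => s (j + i)) := by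
    intro j
    induction j with
    | zero =>
      have : (fun i : Fin (m + 1) => s (0 + i)) = x := by
        funext i
        simpa [s] using fun h : m < (i : ℕ) => absurd i.isLt (by omega)
      rw [this]
    | succ j ih =>
      refine ih.trans (step _ _ ?_)
      funext i
      simp only [Fin.tail, Fin.init, Fin.val_succ, Fin.val_castSucc]
      congr 1
      omega
  have hy : (fun i : Fin (m + 1) => s (m + 1 + i)) = y := by
    funext i
    have : Fin.ofNat (m + 1) (m + 1 + i) = i := by
      ext
      simp [Fin.ofNat, Nat.mod_eq_of_lt i.isLt]
    simp only [s, this]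
    exact if_neg (by omega)
  exact hy ▸ key (m + 1)

theorem apply_eq_apply_zero_of_init_eq_tail {u : Fin (m + 1) → Fin k}
    (hu : Fin.init u = Fin.tail u) (i : Fin (m + 1)) : u i = u 0 := by
  induction i using Fin.induction with
  | zero => rfl
  | succ i ih => exact (congrFun hu i).symm.trans ih

theorem eq_of_init_eq_of_tail_eq {u w : Fin (m + 2) → Fin k} (hi : Fin.init u = Fin.init w)
    (ht : Fin.tail u = Fin.tail w) : u = w := by
  funext i
  refine Fin.cases ?_ (fun j => congrFun ht j) i
  exact congrFun hi 0

/-- A permutation along edges with `σ a = b` consists of one cycle as soon as all words other than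
`a` with a common tail share their cycle, unless `k = 2` and `a`, `b` are special. -/
theorem IsEdgePerm.sameCycle_of_tail {a b : Fin (m + 2) → Fin k}
    {σ : Perm (Fin (m + 2) → Fin k)} (hσ : IsEdgePerm σ) (hk : 2 ≤ k) (hσab : σ a = b)
    (hab : a ≠ b) (hex : ¬ (k = 2 ∧ OutSpecial a ∧ InSpecial b))
    (hsame : ∀ w w', w ≠ a → w' ≠ a → Fin.tail w = Fin.tail w' → σ.SameCycle w w') :
    ∀ x y, σ.SameCycle x y := by
  set v₀ := Fin.tail a with hv₀
  have hb₀ : Fin.init b = v₀ := by rw [hv₀, hσ, hσab]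
  -- at a vertex other than `v₀` all edges lie in one cycle
  have tail_tail : ∀ w w', Fin.tail w ≠ v₀ → Fin.tail w = Fin.tail w' → σ.SameCycle w w' := by
    intro w w' h h'
    refine hsame w w' ?_ ?_ h'
    · rintro rfl; exact h rfl
    · rintro rfl; exact h h'
  have tail_init : ∀ w u, Fin.tail w ≠ v₀ → Fin.tail w = Fin.init u → σ.SameCycle w u := by
    intro w u h h'
    rw [← σ.apply_symm_apply u, sameCycle_apply_right]
    exact tail_tail _ _ h (by rw [h', hσ, apply_symm_apply])
  have tail_init' : ∀ w u, w ≠ a → u ≠ b → Fin.tail w = Fin.init u → σ.SameCycle w u := by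
    intro w u hw hu h'
    rw [← σ.apply_symm_apply u, sameCycle_apply_right]
    refine hsame _ _ hw (fun e => hu ?_) (by rw [h', hσ, apply_symm_apply])
    rw [← hσab, ← e, apply_symm_apply]
  obtain ⟨π, hπ, hπc⟩ := exists_hamiltonian_perm m k
  have : NeZero k := ⟨by omega⟩
  have : Nontrivial (Fin k) := Fin.nontrivial_iff_two_le.2 hk
  have hπv : π v₀ ≠ v₀ := by
    intro h
    obtain ⟨v, hv⟩ := exists_ne v₀
    exact hv ((hπc v₀ v).eq_of_left h).symm
  let r : Fin (m + 2) → Fin k := Fin.cons 0 (π v₀)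
  have hr : Fin.tail r = π v₀ := Fin.tail_cons _ _
  have hr₀ : Fin.tail r ≠ v₀ := by rwa [hr]
  -- Follow `π` from `v₀`: the walk restarts at `r` after each visit to `v₀`, and elsewhere crosses
  -- from one vertex to the next.
  have key : ∀ i : ℕ, (π ^ i) v₀ = v₀ ∨ ∀ w, Fin.tail w = (π ^ i) v₀ → σ.SameCycle r w := by
    intro i
    induction i with
    | zero => left; rfl
    | succ i ih =>
      rw [pow_succ', mul_apply]
      by_cases h0 : (π ^ i) v₀ = v₀
      · right
        intro w hw
        rw [h0] at hw
        exact tail_tail _ _ hr₀ (by rw [hr, hw])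
      have ih := ih.resolve_left h0
      by_cases h1 : π ((π ^ i) v₀) = v₀
      · exact Or.inl h1
      right
      intro w hw
      let u : Fin (m + 2) → Fin k := Fin.cons ((π ^ i) v₀ 0) (π ((π ^ i) v₀))
      have hut : Fin.tail u = π ((π ^ i) v₀) := Fin.tail_cons _ _
      have hui : Fin.init u = (π ^ i) v₀ := by
        funext j
        refine Fin.cases rfl (fun j => ?_) j
        exact (congrFun (hπ ((π ^ i) v₀)) j).symm
      let t : Fin (m + 2) → Fin k := Fin.cons 0 ((π ^ i) v₀)
      have ht : Fin.tail t = (π ^ i) v₀ := Fin.tail_cons _ _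
      exact ((ih t ht).trans (tail_init t u (by rwa [ht]) (by rw [ht, hui]))).trans
        (tail_tail u w (by rwa [hut]) (by rw [hut, hw]))
  have hT : ∀ w, Fin.tail w ≠ v₀ → σ.SameCycle r w := by
    intro w hw
    obtain ⟨i, hi⟩ := (hπc v₀ (Fin.tail w)).exists_nat_pow_eq
    exact (key i).resolve_left (by rwa [hi]) w hi.symm
  have hI : ∀ u, Fin.init u ≠ v₀ → σ.SameCycle r u := by
    intro u hu
    let t : Fin (m + 2) → Fin k := Fin.cons 0 (Fin.init u)
    have ht : Fin.tail t = Fin.init u := Fin.tail_cons _ _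
    exact (hT t (by rwa [ht])).trans (tail_init t u (by rwa [ht]) ht)
  have hA : σ.SameCycle a b := by rw [← hσab, sameCycle_apply_right]
  suffices hall : ∀ u, σ.SameCycle r u from fun x y => (hall x).symm.trans (hall y)
  intro u
  by_cases hui : Fin.init u = v₀
  swap
  · exact hI u hui
  by_cases hut : Fin.tail u = v₀
  swap
  · exact hT u hut
  -- Now `u` is a loop at `v₀`; any other edge into `v₀` starts at another vertex.
  have hnl : ∀ w, w ≠ u → Fin.tail w = v₀ → σ.SameCycle r w := fun w hw hwt =>
    hI w fun hwi => hw (eq_of_init_eq_of_tail_eq (hwi.trans hui.symm) (hwt.trans hut.symm))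
  by_cases hua : u = a
  · have : Fin.tail b ≠ v₀ := fun h =>
      hab (hua ▸ eq_of_init_eq_of_tail_eq (hui.trans hb₀.symm) (hut.trans h.symm))
    rw [hua]
    exact (hT b this).trans hA.symm
  by_cases hub : u = b
  · rw [hub]
    exact (hnl a (fun h => hua h.symm) rfl).trans hA
  have hconst := apply_eq_apply_zero_of_init_eq_tail (hui.trans hut.symm)
  have hk3 : k ≠ 2 := by
    intro hk2
    refine hex ⟨hk2, ⟨u 0, a 0, fun h => hua ?_, fun i => ?_⟩,
      ⟨u 0, b (Fin.last _), fun h => hub ?_, fun i => ?_⟩⟩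
    · funext i
      refine Fin.cases h.symm (fun j => ?_) i
      exact congrFun hut j
    · refine Fin.cases (by simp) (fun j => ?_) i
      have : a j.succ = u j.succ := (congrFun hut j).symm
      simp [this, hconst]
    · funext i
      refine Fin.lastCases ?_ (fun j => ?_) i
      · rw [h, hconst]
      · exact congrFun (hui.trans hb₀.symm) j
    · refine Fin.lastCases (by simp) (fun j => ?_) i
      have : b j.castSucc = u j.castSucc := (congrFun (hui.trans hb₀.symm) j).symm
      have hj : (j : ℕ) ≠ m + 1 := j.isLt.ne
      simp [this, hconst, hj]
  -- With `k ≥ 3`, a third edge into `v₀` avoids both `a` and the loop `u`.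
  obtain ⟨c, hc⟩ : ∃ c : Fin k, c ∉ ({a 0, u 0} : Finset (Fin k)) := by
    by_contra! h
    have h1 := Finset.card_le_card (fun x _ => h x : Finset.univ ⊆ ({a 0, u 0} : Finset (Fin k)))
    have h2 := Finset.card_le_two (a := a 0) (b := u 0)
    rw [Finset.card_univ, Fintype.card_fin] at h1
    omega
  simp only [Finset.mem_insert, Finset.mem_singleton, not_or] at hc
  let w : Fin (m + 2) → Fin k := Fin.cons c v₀
  have hw : Fin.tail w = v₀ := Fin.tail_cons _ _
  have hwa : w ≠ a := fun h => hc.1 (congrFun h 0)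
  have hwu : w ≠ u := fun h => hc.2 (congrFun h 0)
  exact (hnl w hwu hw).trans (hsame w u hwa hua (hw.trans hut.symm))

end Words

/-! ### Cyclic permutations and Hamiltonian lists -/

section Lists

theorem exists_isHamiltonianCycle_of_perm {V : Type*} [Fintype V] [DecidableEq V]
    {G : Digraph V} {σ : Perm V} (hσ : ∀ w, G.Adj w (σ w)) (hc : ∀ x y, σ.SameCycle x y)
    {a : V} (ha : σ a ≠ a) : ∃ l, IsHamiltonianCycle G l ∧ GoesThrough l a (σ a) := by
  -- Listing from `σ a` makes `a → σ a` the closing edge; at a fixed point `toList` would be empty.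
  have hmem : σ a ∈ σ.support := by
    rw [Perm.mem_support]; exact fun h => ha (σ.injective h)
  have hlen := length_toList_pos_of_mem_support σ (σ a) hmem
  have hne : toList σ (σ a) ≠ [] := List.ne_nil_of_length_pos hlen
  have hhead : (toList σ (σ a)).head hne = σ a := by
    rw [List.head_eq_getElem, getElem_toList]; rfl
  have hlast : (toList σ (σ a)).getLast hne = a := by
    have h1 := formPerm_toList σ (σ a)
    have h2 : (toList σ (σ a)).formPerm ((toList σ (σ a)).getLast hne)
        = (toList σ (σ a)).head hne := by
      generalize toList σ (σ a) = l at hne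
      cases l with
      | nil => exact absurd rfl hne
      | cons x xs => exact List.formPerm_apply_getLast x xs
    rw [h1, (hc _ _).cycleOf_apply, hhead] at h2
    exact σ.injective h2
  refine ⟨toList σ (σ a), ⟨⟨⟨nodup_toList _ _, ?_⟩, fun v => ?_⟩, hne, ?_⟩,
    Or.inr ⟨hne, hlast, hhead⟩⟩
  · rw [List.isChain_iff_getElem]
    intro i hi
    rw [getElem_toList, getElem_toList, pow_succ', mul_apply]
    exact hσ _
  · exact mem_toList_iff.2 ⟨hc _ _, hmem⟩
  · rw [hlast, hhead]
    exact hσ _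

theorem IsHamiltonianCycle.adj_formPerm {V : Type*} [DecidableEq V] {G : Digraph V} {l : List V}
    (hl : IsHamiltonianCycle G l) (v : V) : G.Adj v (l.formPerm v) := by
  obtain ⟨⟨⟨hnd, hch⟩, hall⟩, hne, hclose⟩ := hl
  obtain ⟨i, hi, rfl⟩ := List.getElem_of_mem (hall v)
  by_cases h : i + 1 < l.length
  · rw [List.formPerm_apply_lt_getElem l hnd i h]
    exact List.isChain_iff_getElem.1 hch i h
  · have h' : i = l.length - 1 := by omega
    subst h'
    rw [List.formPerm_apply_getElem l hnd]
    rw [List.getLast_eq_getElem, List.head_eq_getElem] at hclose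
    have : (l.length - 1 + 1) % l.length = 0 := by
      rw [Nat.sub_add_cancel (by omega), Nat.mod_self]
    simpa only [this] using hclose

theorem GoesThrough.formPerm_apply {V : Type*} [DecidableEq V] {l : List V} (hl : l.Nodup)
    {a b : V} (h : GoesThrough l a b) : l.formPerm a = b := by
  rcases h with ⟨s, t, rfl⟩ | ⟨hne, rfl, rfl⟩
  · have := List.formPerm_apply_lt_getElem _ hl s.length (by simp)
    simpa using this
  · cases l with
    | nil => exact absurd rfl hne
    | cons x xs => exact List.formPerm_apply_getLast x xs

end Lists

/-- The constant word `u` has only `a` and itself as predecessors. Since `a` is followed by `b ≠ u`,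
`u` would have to follow itself. -/
theorem not_goesThrough_of_special {m : ℕ} {a b : Fin (m + 2) → Fin 2} (ha : OutSpecial a)
    (hb : InSpecial b) (hab : Fin.tail a = Fin.init b) {l : List (Fin (m + 2) → Fin 2)}
    (hl : IsHamiltonianCycle (graph (m + 2) 2) l) : ¬ GoesThrough l a b := by
  intro hg
  have hgo := hg.formPerm_apply hl.1.1.1
  obtain ⟨x, y, hyx, ha⟩ := ha
  obtain ⟨x', y', hyx', hb⟩ := hb
  have hx : x' = x := by
    have := congrFun hab 0
    simpa [Fin.tail, Fin.init, ha, hb] using this.symm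
  subst hx
  let u : Fin (m + 2) → Fin 2 := fun _ => x'
  have hua : a ≠ u := fun h => hyx (by simpa [ha, u] using congrFun h 0)
  have hub : b ≠ u := fun h => hyx' (by simpa [hb, u] using congrFun h (Fin.last _))
  obtain ⟨p, hp⟩ := l.formPerm.surjective u
  have hadj := graph_adj_iff.1 (hl.adj_formPerm p)
  rw [hp] at hadj
  have hps : ∀ i : Fin (m + 1), p i.succ = x' := fun i => congrFun hadj i
  by_cases hp0 : p 0 = x'
  · have hpu : p = u := by
      funext i
      exact Fin.cases hp0 hps i
    rw [hpu, List.formPerm_apply_mem_eq_self_iff _ hl.1.1.1 u (hl.1.2 u)] at hp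
    have hsub : ∀ v ∈ l, ∀ w ∈ l, v = w := by
      match l, hp with
      | [], _ => simp
      | [z], _ => simp
    exact hua (hsub a (hl.1.2 a) u (hl.1.2 u))
  · have hpa : p = a := by
      funext i
      refine Fin.cases ?_ (fun j => ?_) i
      · have : a 0 = y := by simp [ha]
        rw [this]
        omega
      · rw [hps, ha]; simp
    rw [hpa, hgo] at hp
    exact hub hp

end DeBruijn

theorem mainTheorem2 (n k : ℕ) (hn : 2 ≤ n) (hk : 2 ≤ k) (a b : Fin n → Fin k)
    (hab : (DeBruijn.graph n k).Adj a b) (hne : a ≠ b) :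
    (∃ l : List (Fin n → Fin k), DeBruijn.IsHamiltonianCycle (DeBruijn.graph n k) l ∧
        DeBruijn.GoesThrough l a b) ↔
      ¬ (k = 2 ∧ DeBruijn.OutSpecial a ∧ DeBruijn.InSpecial b) := by
  obtain ⟨m, rfl⟩ := Nat.exists_eq_add_of_le' hn
  have hab' := DeBruijn.graph_adj_iff.1 hab
  constructor
  · rintro ⟨l, hl, hg⟩ ⟨rfl, ha, hb⟩
    exact DeBruijn.not_goesThrough_of_special ha hb hab' hl hg
  · intro hex
    obtain ⟨σ, ⟨hσ, hσab⟩, hsame⟩ := DeBruijn.exists_sameCycle_of_swap_stable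
      {σ : Equiv.Perm (Fin (m + 2) → Fin k) | DeBruijn.IsEdgePerm σ ∧ σ a = b}
      (DeBruijn.exists_isEdgePerm_apply_eq hab')
      (fun w w' => w ≠ a ∧ w' ≠ a ∧ Fin.tail w = Fin.tail w') (by
        rintro σ ⟨hσ, hσab⟩ w w' ⟨hw, hw', h⟩
        refine ⟨hσ.mul_swap h, ?_⟩
        rw [Equiv.Perm.mul_apply, Equiv.swap_apply_of_ne_of_ne hw.symm hw'.symm, hσab])
    have hc := hσ.sameCycle_of_tail hk hσab hne hex
      (fun w w' hw hw' h => hsame w w' ⟨hw, hw', h⟩)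
    subst hσab
    exact DeBruijn.exists_isHamiltonianCycle_of_perm
      (fun w => DeBruijn.graph_adj_iff.2 (hσ w)) hc hne.symm
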